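/- Let $(a_n)_{n\in\mathbb Z}$ and $(b_n)_{n\in\mathbb Z}$ be real sequences with $a_n>0$ for all $n$ and $\sup_n(|a_n|+|b_n|)<\infty$, and let $J$ be the bounded self-adjoint operator on the complex Hilbert space $\ell^2(\mathbb Z)$ given by $$(Ju)_n=a_{n-1}u_{n-1}+b_nu_n+a_nu_{n+1}.$$ Then $J$ has simple singular spectrum. That is, let $\mathcal H_{\mathrm s}$ be the set of all $\varphi\in\ell^2(\mathbb Z)$ whose spectral measure $\mu_\varphi$ for $J$ (the Borel measure on $\mathbb R$ with $\int f\,d\mu_\varphi=\langle\varphi,f(J)\varphi\rangle$ for all compactly supported continuous $f:\mathbb R\to\mathbb R$) is singular with respect to Lebesgue measure; then the restriction of $J$ to $\mathcal H_{\mathrm s}$ has a cyclic vector: there is $\psi$ such that $\mathcal H_{\mathrm s}$ is the closed linear span of $\{J^k\psi : k\ge 0\}$. -/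

import Mathlib

open MeasureTheory
open scoped CompactlySupported

noncomputable section

section SpectralTheory

variable {H : Type*} [NormedAddCommGroup H] [InnerProductSpace ℂ H] [CompleteSpace H]

/-- The positive functional `f ↦ ⟨ψ, f(A) ψ⟩` on compactly supported continuous real functions,
where `f(A)` is given by the continuous functional calculus of the bounded self-adjoint
operator `A`. -/
def spectralFunctional (A : H →L[ℂ] H) (ψ : H) : C_c(ℝ, ℝ) →ₚ[ℝ] ℝ :=
  PositiveLinearMap.mk₀
    { toFun := fun f => (inner ℂ ψ (cfc (f : ℝ → ℝ) A ψ)).re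
      map_add' := fun f g => by
        rw [← Complex.add_re, ← inner_add_right, ← add_apply,
          ← cfc_add (a := A) (f := f) (g := g) (by fun_prop) (by fun_prop)]
        rfl
      map_smul' := fun c f => by
        have h : cfc (fun x => c • f x) A = c • cfc (f : ℝ → ℝ) A :=
          cfc_smul c (f : ℝ → ℝ) A (by fun_prop)
        change (inner ℂ ψ (cfc (fun x => c • f x) A ψ)).re = c • _
        rw [h, smul_apply, inner_smul_right_eq_smul, Complex.smul_re] }
    (fun f hf => by
      have h : 0 ≤ cfc (f : ℝ → ℝ) A := cfc_nonneg fun x _ => hf x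
      exact ((ContinuousLinearMap.nonneg_iff_isPositive _).1 h).re_inner_nonneg_right ψ)

/-- The spectral measure of the vector `ψ` for the bounded self-adjoint operator `A`: the Borel
measure on `ℝ` representing `f ↦ ⟨ψ, f(A) ψ⟩` (Riesz–Markov–Kakutani). -/
def spectralMeasure (A : H →L[ℂ] H) (ψ : H) : Measure ℝ :=
  RealRMK.rieszMeasure (spectralFunctional A ψ)

theorem integral_spectralMeasure (A : H →L[ℂ] H) (ψ : H) (f : C_c(ℝ, ℝ)) :
    ∫ x, f x ∂(spectralMeasure A ψ) = (inner ℂ ψ (cfc (f : ℝ → ℝ) A ψ)).re :=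
  RealRMK.integral_rieszMeasure (spectralFunctional A ψ) f

/-- The closed linear span of `ψ, Aψ, A²ψ, …`. -/
def cyclicSubspace (A : H →L[ℂ] H) (ψ : H) : Submodule ℂ H :=
  (Submodule.span ℂ (Set.range fun n : ℕ => (A ^ n) ψ)).topologicalClosure

/-- The singular subspace of the self-adjoint operator `A`, as a set: the vectors whose spectral
measure is singular with respect to Lebesgue measure (point part and singular continuous part
together). -/
def singularSubspace (A : H →L[ℂ] H) : Set H :=
  {φ | spectralMeasure A φ ⟂ₘ (volume : Measure ℝ)}

/-- The self-adjoint operator `A` has simple singular spectrum: its restriction to the singular subspace has a cyclic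
vector. (If the singular subspace is zero, `ψ = 0` is cyclic.) -/
def HasSimpleSingularSpectrum (A : H →L[ℂ] H) : Prop :=
  IsSelfAdjoint A ∧ ∃ ψ : H, (cyclicSubspace A ψ : Set H) = singularSubspace A

end SpectralTheory

section Jacobi

/-- The complex Hilbert space `ℓ²(ℤ)`. -/
abbrev L2Z : Type := lp (fun _ : ℤ => ℂ) 2

theorem memlp_weightedShift (c : ℤ → ℝ) (k : ℤ) (C : ℝ) (hC : ∀ n, |c n| ≤ C) (u : L2Z) :
    Memℓp (fun n => (c n : ℂ) * u (n + k)) 2 := by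
  have hu : Summable fun n => ‖u n‖ ^ (2 : ENNReal).toReal :=
    (lp.memℓp u).summable (by norm_num)
  have hu' : Summable fun n => ‖u (n + k)‖ ^ (2 : ENNReal).toReal :=
    (Equiv.addRight k).summable_iff.2 hu
  refine memℓp_gen ((hu'.mul_left (C ^ 2)).of_nonneg_of_le (fun n => by positivity) fun n => ?_)
  simp only [ENNReal.toReal_ofNat, Real.rpow_ofNat, norm_mul, mul_pow, Complex.norm_real,
    Real.norm_eq_abs]
  gcongr
  exact hC n

/-- The bounded operator `u ↦ (c_n u_{n+k})_n` on `ℓ²(ℤ)`, for a bounded sequence `c`. -/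
def weightedShift (c : ℤ → ℝ) (k : ℤ) (hc : ∃ C, ∀ n, |c n| ≤ C) : L2Z →L[ℂ] L2Z :=
  LinearMap.mkContinuousOfExistsBound
    { toFun := fun u =>
        ⟨fun n => (c n : ℂ) * u (n + k), memlp_weightedShift c k _ hc.choose_spec u⟩
      map_add' := fun u v => by
        ext n
        simp only [mul_add, lp.coeFn_add, Pi.add_apply]
      map_smul' := fun z u => by
        ext n
        simp [mul_left_comm] }
    (by
      obtain ⟨C, hC⟩ := hc
      have hC0 : 0 ≤ C := (abs_nonneg _).trans (hC 0)
      refine ⟨C, fun u => ?_⟩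
      have hu : HasSum (fun n => ‖u n‖ ^ (2 : ENNReal).toReal) (‖u‖ ^ (2 : ENNReal).toReal) :=
        lp.hasSum_norm (by norm_num) u
      have hu' : HasSum (fun n => ‖u (n + k)‖ ^ (2 : ENNReal).toReal)
          (‖u‖ ^ (2 : ENNReal).toReal) :=
        (Equiv.addRight k).hasSum_iff.2 hu
      have hv := lp.hasSum_norm (p := 2) (by norm_num)
        (⟨fun n => (c n : ℂ) * u (n + k), memlp_weightedShift c k C hC u⟩ : L2Z)
      refine le_of_sq_le_sq ?_ (by positivity)
      have := hasSum_le (fun n => ?_) hv (hu'.mul_left (C ^ 2))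
      · simpa [mul_pow] using this
      · simp only [ENNReal.toReal_ofNat, Real.rpow_ofNat, norm_mul, mul_pow, Complex.norm_real,
          Real.norm_eq_abs]
        gcongr
        exact hC n)

theorem weightedShift_apply (c : ℤ → ℝ) (k : ℤ) (hc : ∃ C, ∀ n, |c n| ≤ C) (u : L2Z) (n : ℤ) :
    weightedShift c k hc u n = (c n : ℂ) * u (n + k) := rfl

/-- The two-sided Jacobi matrix as a bounded operator on `ℓ²(ℤ)`. -/
def jacobi (a b : ℤ → ℝ) (h : BddAbove (Set.range fun n => |a n| + |b n|)) : L2Z →L[ℂ] L2Z :=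
  weightedShift (fun n => a (n - 1)) (-1)
      (h.imp fun _ hC n => (le_add_of_nonneg_right (abs_nonneg _)).trans (hC ⟨n - 1, rfl⟩))
    + weightedShift b 0
      (h.imp fun _ hC n => (le_add_of_nonneg_left (abs_nonneg _)).trans (hC ⟨n, rfl⟩))
    + weightedShift a 1
      (h.imp fun _ hC n => (le_add_of_nonneg_right (abs_nonneg _)).trans (hC ⟨n, rfl⟩))

theorem jacobi_apply (a b : ℤ → ℝ) (h : BddAbove (Set.range fun n => |a n| + |b n|))
    (u : L2Z) (n : ℤ) :
    jacobi a b h u n = a (n - 1) * u (n - 1) + b n * u n + a n * u (n + 1) := by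
  change (a (n - 1) : ℂ) * u (n + -1) + b n * u (n + 0) + a n * u (n + 1) = _
  rw [add_zero, ← sub_eq_add_neg]

theorem isSelfAdjoint_jacobi (a b : ℤ → ℝ) (h : BddAbove (Set.range fun n => |a n| + |b n|)) :
    IsSelfAdjoint (jacobi a b h) := by
  rw [ContinuousLinearMap.isSelfAdjoint_iff_isSymmetric]
  intro u v
  change inner ℂ (jacobi a b h u) v = inner ℂ u (jacobi a b h v)
  unfold jacobi
  simp only [add_apply, inner_add_left, inner_add_right]
  have key : ∀ (c d : ℤ → ℝ) (k : ℤ) (hc : ∃ C, ∀ n, |c n| ≤ C) (hd : ∃ C, ∀ n, |d n| ≤ C),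
      (∀ n, d n = c (n - k)) →
      inner ℂ (weightedShift c k hc u) v = inner ℂ u (weightedShift d (-k) hd v) := by
    intro c d k hc hd hcd
    rw [lp.inner_eq_tsum, lp.inner_eq_tsum, ← (Equiv.addRight k).tsum_eq
      (fun n => inner ℂ (u n) (weightedShift d (-k) hd v n))]
    congr 1
    ext n
    simp [weightedShift_apply, hcd]
    ring
  have h1 := fun p q => key (fun n => a (n - 1)) a (-1) p q (fun n => by simp)
  have h2 := fun p q => key b b 0 p q (fun n => by simp)
  have h3 := fun p q => key a (fun n => a (n - 1)) 1 p q (fun n => by simp)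
  simp only [neg_neg, neg_zero] at h1 h2 h3
  have hA : ∃ C, ∀ n, |a n| ≤ C :=
    h.imp fun _ hC n => (le_add_of_nonneg_right (abs_nonneg _)).trans (hC ⟨n, rfl⟩)
  have hB : ∃ C, ∀ n, |b n| ≤ C :=
    h.imp fun _ hC n => (le_add_of_nonneg_left (abs_nonneg _)).trans (hC ⟨n, rfl⟩)
  rw [h1 _ hA, h2 _ hB, h3 _ (hA.imp fun _ hC n => hC (n - 1))]
  ring

end Jacobi

end

/-! The spectrum has multiplicity at most two, since `δ₀` and `δ₁` together generate `ℓ²(ℤ)`. Let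
`P` project onto the cyclic subspace of `φ = δ₀ + iδ₁`. Its complement is generated by `χ = δ₀ -
Pδ₀`, and `δ₁ - Pδ₁ = iχ`. The half-line Weyl solution `f` satisfies `(J - z)f = δ₁ + a₀mδ₀` with
`Im m = Im z ‖f‖²`. Applying `1 - P` gives `(J - z)(f - Pf) = (i + a₀m)χ`, so the resolvent at `z =
x + iε` sends `χ` to `w = (f - Pf)/(i + a₀m)`. With `t = ε‖f‖²`, `ε‖w‖² ≤ t/(1 + a₀t)² ≤ 1/(4a₀)`.
The left side is the Poisson integral of the spectral measure of `χ`, so this measure is absolutely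
continuous (`absolutelyContinuous_spectralMeasure`).

Singular vectors are then orthogonal to the complement and lie in the cyclic subspace of `φ`; the
projection of `φ` to the singular subspace is cyclic there
(`hasSimpleSingularSpectrum_of_absolutelyContinuous`). -/

open MeasureTheory
open scoped CompactlySupported ENNReal

/-! ### Comparison and absolute continuity of measures on the line. -/

section Measures

/-- Comparison of locally finite measures on `ℝ` through nonnegative test functions. -/
theorem measure_le_of_forall_integral_le {μ ν : Measure ℝ} [IsLocallyFiniteMeasure μ]
    [IsLocallyFiniteMeasure ν]
    (h : ∀ f : C_c(ℝ, ℝ), (∀ x, 0 ≤ f x) → ∫ x, f x ∂μ ≤ ∫ x, f x ∂ν) : μ ≤ ν := by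
  have hK : ∀ K : Set ℝ, IsCompact K → μ K ≤ ν K := by
    intro K hK
    rw [hK.measure_eq_biInf_integral_hasCompactSupport μ,
      hK.measure_eq_biInf_integral_hasCompactSupport ν]
    refine iInf_mono fun f => iInf_mono fun hf => iInf_mono fun hfc => iInf_mono fun _ =>
      iInf_mono fun hf0 => ENNReal.ofReal_le_ofReal ?_
    exact h ⟨⟨f, hf⟩, hfc⟩ hf0
  have hU : ∀ U : Set ℝ, IsOpen U → μ U ≤ ν U := by
    intro U hU
    rw [hU.measure_eq_iSup_isCompact μ]
    exact iSup₂_le fun K hKU => iSup_le fun hKc => (hK K hKc).trans (measure_mono hKU)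
  refine Measure.le_iff.2 fun s _ => ?_
  rw [s.measure_eq_iInf_isOpen ν]
  exact le_iInf₂ fun U hsU => le_iInf fun hUo => (measure_mono hsU).trans (hU U hUo)

/-- A measure dominated on all closed balls by a multiple of Lebesgue measure is absolutely
continuous. -/
theorem absolutelyContinuous_of_closedBall_le {μ : Measure ℝ} [IsLocallyFiniteMeasure μ]
    (C : ℝ) (h : ∀ x ε : ℝ, 0 < ε → μ (Metric.closedBall x ε) ≤ ENNReal.ofReal (C * ε)) :
    μ ≪ (volume : Measure ℝ) := by
  have hle : ∀ s, μ s ≤ (Real.toNNReal C • (volume : Measure ℝ)) s := by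
    intro s
    -- Besicovitch covering needs no doubling property, so balls can be used for `μ` itself.
    refine (Besicovitch.vitaliFamily μ).measure_le_of_frequently_le _
      Measure.AbsolutelyContinuous.rfl s fun x _ => ?_
    refine (Besicovitch.tendsto_filterAt μ x).frequently (Filter.Eventually.frequently ?_)
    filter_upwards [self_mem_nhdsWithin] with ε hε
    have hε' : (0 : ℝ) < ε := hε
    refine (h x ε hε').trans ?_
    rw [Measure.smul_apply, Real.volume_closedBall, ENNReal.smul_def, smul_eq_mul,
      ← ENNReal.ofReal, ← ENNReal.ofReal_mul' (by positivity)]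
    by_cases hC : 0 ≤ C
    · exact ENNReal.ofReal_le_ofReal (by nlinarith)
    · rw [ENNReal.ofReal_of_nonpos (by nlinarith)]
      exact zero_le
  refine Measure.AbsolutelyContinuous.mk fun s _ hs => ?_
  refine le_antisymm ((hle s).trans ?_) zero_le
  simp [Measure.smul_apply, hs]

end Measures

/-! ### Cyclic subspaces. -/

section Cyclic

variable {H : Type*} [NormedAddCommGroup H] [InnerProductSpace ℂ H]

theorem apply_mem_cyclicSubspace (A : H →L[ℂ] H) (ψ : H) {u : H} (hu : u ∈ cyclicSubspace A ψ) :
    A u ∈ cyclicSubspace A ψ := by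
  have hle : (cyclicSubspace A ψ) ≤ (cyclicSubspace A ψ).comap A.toLinearMap := by
    refine Submodule.topologicalClosure_minimal _ (Submodule.span_le.2 ?_)
      ((Submodule.isClosed_topologicalClosure _).preimage A.continuous)
    rintro _ ⟨n, rfl⟩
    refine Submodule.le_topologicalClosure _ (Submodule.subset_span ⟨n + 1, ?_⟩)
    simp [pow_succ']
  exact hle hu

theorem self_mem_cyclicSubspace (A : H →L[ℂ] H) (ψ : H) : ψ ∈ cyclicSubspace A ψ :=
  Submodule.le_topologicalClosure _ (Submodule.subset_span ⟨0, by simp⟩)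

theorem cyclicSubspace_le {A : H →L[ℂ] H} {ψ : H} {K : Submodule ℂ H} (hK : IsClosed (K : Set H))
    (hA : ∀ u ∈ K, A u ∈ K) (hψ : ψ ∈ K) : cyclicSubspace A ψ ≤ K := by
  refine Submodule.topologicalClosure_minimal _ (Submodule.span_le.2 ?_) hK
  rintro _ ⟨n, rfl⟩
  induction n with
  | zero => simpa using hψ
  | succ n ih => simpa [pow_succ'] using hA _ ih

instance completeSpace_cyclicSubspace [CompleteSpace H] (A : H →L[ℂ] H) (ψ : H) :
    CompleteSpace (cyclicSubspace A ψ) :=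
  (Submodule.isClosed_topologicalClosure _).completeSpace_coe

end Cyclic

/-! ### Spectral measures, the singular subspace and the resolvent criterion. -/

section Spectral

variable {H : Type*} [NormedAddCommGroup H] [InnerProductSpace ℂ H] [CompleteSpace H]

instance regular_spectralMeasure (A : H →L[ℂ] H) (ψ : H) : (spectralMeasure A ψ).Regular :=
  RealRMK.regular_rieszMeasure _

theorem norm_cfc_apply_sq (A : H →L[ℂ] H) {f : ℝ → ℝ} (hf : Continuous f) (ψ : H) :
    ‖cfc f A ψ‖ ^ 2 = (inner ℂ ψ (cfc (fun x => f x * f x) A ψ)).re := by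
  have hsa : IsSelfAdjoint (cfc f A) := cfc_predicate f A
  have hsym : inner ℂ (cfc f A ψ) (cfc f A ψ) = inner ℂ ψ (cfc f A (cfc f A ψ)) :=
    (ContinuousLinearMap.isSelfAdjoint_iff_isSymmetric.1 hsa) ψ _
  rw [cfc_mul f f A, mul_apply_eq_comp, ← hsym]
  exact (inner_self_eq_norm_sq (𝕜 := ℂ) _).symm

theorem norm_cfc_apply_sq_eq_integral (A : H →L[ℂ] H) (f : C_c(ℝ, ℝ)) (ψ : H) :
    ‖cfc (f : ℝ → ℝ) A ψ‖ ^ 2 = ∫ x, f x * f x ∂(spectralMeasure A ψ) := by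
  rw [norm_cfc_apply_sq A (map_continuous f)]
  exact (integral_spectralMeasure A ψ (f * f)).symm

theorem re_inner_cfc_apply (A : H →L[ℂ] H) {f : ℝ → ℝ} (hf : Continuous f) (h0 : ∀ x, 0 ≤ f x)
    (ψ : H) : (inner ℂ ψ (cfc f A ψ)).re = ‖cfc (fun x => √(f x)) A ψ‖ ^ 2 := by
  rw [norm_cfc_apply_sq A (by fun_prop)]
  simp_rw [Real.mul_self_sqrt (h0 _)]

/-- Spectral measures are compared through the vectors `g(A) ψ`. -/
theorem spectralMeasure_le (A : H →L[ℂ] H) {ψ : H} {ν : Measure ℝ} [IsLocallyFiniteMeasure ν]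
    (h : ∀ f : C_c(ℝ, ℝ), (∀ x, 0 ≤ f x) →
      ‖cfc (fun x => √(f x)) A ψ‖ ^ 2 ≤ ∫ x, f x ∂ν) : spectralMeasure A ψ ≤ ν :=
  measure_le_of_forall_integral_le fun f hf => by
    rw [integral_spectralMeasure, re_inner_cfc_apply A (map_continuous f) hf]
    exact h f hf

theorem integral_spectralMeasure_eq_norm_sq (A : H →L[ℂ] H) (ψ : H) (f : C_c(ℝ, ℝ))
    (hf : ∀ x, 0 ≤ f x) :
    ∫ x, f x ∂(spectralMeasure A ψ) = ‖cfc (fun x => √(f x)) A ψ‖ ^ 2 := by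
  rw [integral_spectralMeasure, re_inner_cfc_apply A (map_continuous f) hf]

theorem integrable_spectralMeasure (A : H →L[ℂ] H) (ψ : H) (f : C_c(ℝ, ℝ)) :
    Integrable f (spectralMeasure A ψ) :=
  f.continuous.integrable_of_hasCompactSupport f.hasCompactSupport

theorem spectralMeasure_univ_le (A : H →L[ℂ] H) (u : H) :
    spectralMeasure A u Set.univ ≤ ENNReal.ofReal (‖u‖ ^ 2) := by
  rw [isOpen_univ.measure_eq_iSup_isCompact]
  refine iSup₂_le fun K _ => iSup_le fun hK => ?_
  obtain ⟨f, hfK, -, hfc, hf⟩ := exists_continuous_one_zero_of_isCompact hK isClosed_empty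
    (Set.disjoint_empty K)
  let F : C_c(ℝ, ℝ) := ⟨f, hfc⟩
  refine ((integrable_spectralMeasure A u F).measure_le_integral
    (.of_forall fun x => (hf x).1) fun x hx => (hfK hx).ge).trans ?_
  refine ENNReal.ofReal_le_ofReal ?_
  rw [integral_spectralMeasure_eq_norm_sq A u F fun x => (hf x).1]
  have h1 : ‖cfc (fun x => √(F x)) A‖ ≤ 1 := by
    refine norm_cfc_le zero_le_one fun x _ => ?_
    rw [Real.norm_of_nonneg (Real.sqrt_nonneg _)]
    exact Real.sqrt_le_one.2 (hf x).2
  gcongr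
  exact ((cfc (fun x => √(F x)) A).le_opNorm u).trans (mul_le_of_le_one_left (norm_nonneg u) h1)

instance isFiniteMeasure_spectralMeasure (A : H →L[ℂ] H) (ψ : H) :
    IsFiniteMeasure (spectralMeasure A ψ) :=
  ⟨(spectralMeasure_univ_le A ψ).trans_lt ENNReal.ofReal_lt_top⟩

theorem spectralMeasure_add_le (A : H →L[ℂ] H) (u v : H) :
    spectralMeasure A (u + v) ≤
      (2 : NNReal) • spectralMeasure A u + (2 : NNReal) • spectralMeasure A v := by
  refine spectralMeasure_le A fun f hf => ?_
  rw [integral_add_measure ((integrable_spectralMeasure A u f).smul_measure_nnreal)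
      ((integrable_spectralMeasure A v f).smul_measure_nnreal), integral_smul_nnreal_measure,
    integral_smul_nnreal_measure, integral_spectralMeasure_eq_norm_sq A u f hf,
    integral_spectralMeasure_eq_norm_sq A v f hf, map_add]
  set x := cfc (fun x => √(f x)) A u
  set y := cfc (fun x => √(f x)) A v
  have := norm_add_le x y
  change _ ≤ 2 * ‖x‖ ^ 2 + 2 * ‖y‖ ^ 2
  nlinarith [sq_nonneg (‖x‖ - ‖y‖), norm_nonneg (x + y)]

/-- An operator commuting with the functional calculus of `A` maps spectral measures to
dominated ones. -/
theorem spectralMeasure_apply_le (A B : H →L[ℂ] H)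
    (hB : ∀ f : ℝ → ℝ, Commute B (cfc f A)) (u : H) :
    spectralMeasure A (B u) ≤ (‖B‖₊ ^ 2) • spectralMeasure A u := by
  refine spectralMeasure_le A fun f hf => ?_
  rw [integral_smul_nnreal_measure, integral_spectralMeasure_eq_norm_sq A u f hf,
    ← mul_apply_eq_comp, ← (hB _).eq, mul_apply_eq_comp]
  change _ ≤ ‖B‖ ^ 2 * _
  rw [← mul_pow]
  gcongr
  exact B.le_opNorm _

/-- One Lebesgue-null set carries the measures of all `v n`. Off it, the measure of the limit `u` is
at most twice the total mass `‖u - v n‖²` of the error, which tends to zero. -/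
theorem isClosed_singularSubspace (A : H →L[ℂ] H) :
    IsClosed (singularSubspace A) := by
  refine isClosed_of_closure_subset fun u hu => ?_
  obtain ⟨v, hv, hvu⟩ := mem_closure_iff_seq_limit.1 hu
  have hs : Measure.sum (fun n => spectralMeasure A (v n)) ⟂ₘ (volume : Measure ℝ) :=
    Measure.MutuallySingular.sum_left.2 hv
  refine ⟨hs.nullSet, hs.measurableSet_nullSet, ?_, hs.measure_compl_nullSet⟩
  have hn : ∀ n, spectralMeasure A (v n) hs.nullSet = 0 := fun n =>
    le_antisymm ((Measure.le_sum _ n _).trans_eq hs.measure_nullSet) zero_le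
  have hle : ∀ n, spectralMeasure A u hs.nullSet ≤ 2 * ENNReal.ofReal (‖u - v n‖ ^ 2) := by
    intro n
    have h := spectralMeasure_add_le A (v n) (u - v n) hs.nullSet
    rw [add_sub_cancel, Measure.add_apply, Measure.smul_apply, Measure.smul_apply, hn,
      smul_zero, zero_add, ENNReal.smul_def, smul_eq_mul] at h
    refine h.trans ?_
    gcongr
    · exact le_rfl
    · exact (measure_mono (Set.subset_univ _)).trans (spectralMeasure_univ_le A _)
  have hlim : Filter.Tendsto (fun n => 2 * ENNReal.ofReal (‖u - v n‖ ^ 2)) Filter.atTop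
      (nhds (2 * ENNReal.ofReal (‖u - u‖ ^ 2))) := by
    refine ENNReal.Tendsto.const_mul (ENNReal.tendsto_ofReal ?_) (by simp)
    exact ((tendsto_const_nhds.sub hvu).norm).pow 2
  simpa using ge_of_tendsto' hlim hle

/-- The singular subspace as a submodule. -/
def singularSubmodule (A : H →L[ℂ] H) : Submodule ℂ H where
  carrier := singularSubspace A
  add_mem' {u v} hu hv :=
    ((hu.smul_nnreal 2).add_left (hv.smul_nnreal 2)).mono (spectralMeasure_add_le A u v) le_rfl
  zero_mem' := by
    have h : spectralMeasure A 0 ≤ 0 := by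
      refine Measure.le_iff.2 fun s _ => (measure_mono (Set.subset_univ s)).trans ?_
      simpa using spectralMeasure_univ_le A 0
    exact Measure.MutuallySingular.zero_left.mono h le_rfl
  smul_mem' c u hu := by
    have h := spectralMeasure_apply_le A (c • (1 : H →L[ℂ] H))
      (fun f => (Commute.one_left _).smul_left c) u
    exact (hu.smul_nnreal _).mono h le_rfl

theorem apply_mem_singularSubmodule {A : H →L[ℂ] H} {u : H}
    (hu : u ∈ singularSubmodule A) : A u ∈ singularSubmodule A :=
  (hu.smul_nnreal _).mono
    (spectralMeasure_apply_le A A (fun f => ((Commute.refl A).cfc_real f).symm) u) le_rfl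

/-- Vectors with mutually singular spectral measures are orthogonal. -/
theorem inner_eq_zero_of_mutuallySingular {A : H →L[ℂ] H} (hA : IsSelfAdjoint A) {u v : H}
    (h : spectralMeasure A u ⟂ₘ spectralMeasure A v) : inner ℂ u v = 0 := by
  set μ := spectralMeasure A u
  set ν := spectralMeasure A v
  -- A compactly supported stand-in for the constant 1: it equals 1 on the spectrum. The factor
  -- `‖1‖` in the radius covers the zero space as well.
  obtain ⟨k, hk1, -, hkc, hk⟩ := exists_continuous_one_zero_of_isCompact
    (ProperSpace.isCompact_closedBall (0 : ℝ) (‖A‖ * ‖(1 : H →L[ℂ] H)‖)) isClosed_empty (Set.disjoint_empty _)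
  let k' : C_c(ℝ, ℝ) := ⟨k, hkc⟩
  have hkA : cfc k' A = 1 := by
    rw [← cfc_const_one ℝ A]
    refine cfc_congr fun x hx => hk1 ?_
    rw [mem_closedBall_zero_iff]
    exact spectrum.norm_le_norm_mul_of_mem hx
  have key : ∀ δ : ℝ, 0 < δ → ‖inner ℂ u v‖ ≤ δ * ‖v‖ + ‖u‖ * δ := by
    intro δ hδ
    -- `g` vanishes `μ`-a.e. and equals `k'` `ν`-a.e. A continuous `F` close to `g` in `L²(μ + ν)`
    -- makes both `F(A)u` and `(k' - F)(A)v` small, and these control the two terms of `⟨u, v⟩ =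
    -- ⟨F(A)u, v⟩ + ⟨u, (k' - F)(A)v⟩`.
    let g : ℝ → ℝ := h.nullSet.indicator k'
    have hg : MemLp g (ENNReal.ofReal 2) (μ + ν) :=
      (((map_continuous k').memLp_of_hasCompactSupport k'.hasCompactSupport).indicator
        h.measurableSet_nullSet)
    obtain ⟨f, hfc, hfi, hf, hfL⟩ := hg.exists_hasCompactSupport_integral_rpow_sub_le
      (by norm_num) (ε := δ ^ 2) (by positivity)
    let F : C_c(ℝ, ℝ) := ⟨⟨f, hf⟩, hfc⟩
    have hint : Integrable (fun x => ‖g x - f x‖ ^ (2 : ℝ)) (μ + ν) := by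
      have := (hg.sub hfL).integrable_norm_rpow (by norm_num) (by norm_num)
      simpa using this
    rw [integral_add_measure (hint.mono_measure (Measure.le_add_right le_rfl))
      (hint.mono_measure (Measure.le_add_left le_rfl))] at hfi
    have h0 : ∀ ρ : Measure ℝ, 0 ≤ ∫ x, ‖g x - f x‖ ^ (2 : ℝ) ∂ρ := fun ρ =>
      integral_nonneg fun x => by positivity
    have hFu : ‖cfc F A u‖ ≤ δ := by
      refine le_of_sq_le_sq ?_ hδ.le
      rw [norm_cfc_apply_sq_eq_integral]
      refine le_trans (le_of_eq ?_) ((le_add_of_nonneg_right (h0 ν)).trans hfi)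
      refine integral_congr_ae ?_
      filter_upwards [measure_eq_zero_iff_ae_notMem.1 h.measure_nullSet] with x hx
      simp only [g, Set.indicator_of_notMem hx, zero_sub, norm_neg, Real.rpow_ofNat,
        Real.norm_eq_abs, sq_abs]
      exact (sq _).symm
    have hFv : ‖cfc (⇑(k' - F)) A v‖ ≤ δ := by
      refine le_of_sq_le_sq ?_ hδ.le
      rw [norm_cfc_apply_sq_eq_integral]
      refine le_trans (le_of_eq ?_) ((le_add_of_nonneg_left (h0 μ)).trans hfi)
      refine integral_congr_ae ?_
      filter_upwards [measure_eq_zero_iff_ae_notMem.1 h.measure_compl_nullSet] with x hx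
      simp only [g, Set.indicator_of_mem (Set.notMem_compl_iff.1 hx), Real.rpow_ofNat,
        Real.norm_eq_abs, sq_abs]
      exact (sq _).symm
    have hsub : cfc (⇑(k' - F)) A = 1 - cfc F A := by
      rw [← hkA]
      exact cfc_sub k' F A
    have hsa : IsSelfAdjoint (cfc F A) := cfc_predicate _ A
    have hsym : inner ℂ (cfc F A u) v = inner ℂ u (cfc F A v) :=
      (ContinuousLinearMap.isSelfAdjoint_iff_isSymmetric.1 hsa) u v
    have hsplit : inner ℂ u v = inner ℂ (cfc F A u) v + inner ℂ u (cfc (⇑(k' - F)) A v) := by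
      rw [hsym, hsub, sub_apply, one_apply_eq_self, inner_sub_right]
      ring
    rw [hsplit]
    refine (norm_add_le _ _).trans (add_le_add ?_ ?_)
    · exact (norm_inner_le_norm _ _).trans (by gcongr)
    · exact (norm_inner_le_norm _ _).trans (by gcongr)
  have hlim : Filter.Tendsto (fun δ : ℝ => δ * ‖v‖ + ‖u‖ * δ) (nhdsWithin 0 (Set.Ioi 0))
      (nhds (0 * ‖v‖ + ‖u‖ * 0)) :=
    ((by fun_prop : Continuous fun δ : ℝ => δ * ‖v‖ + ‖u‖ * δ).tendsto 0).mono_left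
      nhdsWithin_le_nhds
  have := ge_of_tendsto hlim
    (by filter_upwards [self_mem_nhdsWithin] with δ hδ using key δ hδ)
  simpa using this

instance completeSpace_singularSubmodule (A : H →L[ℂ] H) :
    CompleteSpace (singularSubmodule A) :=
  (isClosed_singularSubspace A).completeSpace_coe

/-- The orthogonal projection onto an invariant subspace commutes with a self-adjoint operator. -/
theorem starProjection_apply_comm {A : H →L[ℂ] H} (hA : IsSelfAdjoint A) (K : Submodule ℂ H)
    [K.HasOrthogonalProjection] (hK : ∀ u ∈ K, A u ∈ K) (u : H) :
    K.starProjection (A u) = A (K.starProjection u) := by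
  refine (Submodule.eq_starProjection_of_mem_of_inner_eq_zero
    (hK _ (K.starProjection_apply_mem u)) fun w hw => ?_)
  rw [← map_sub]
  have hsym : inner ℂ (A (u - K.starProjection u)) w = inner ℂ (u - K.starProjection u) (A w) :=
    (ContinuousLinearMap.isSelfAdjoint_iff_isSymmetric.1 hA) _ w
  rw [hsym]
  exact K.starProjection_inner_eq_zero _ _ (hK w hw)

/-- If `φ` and `e` generate the space and the component of `e` orthogonal to the cyclic subspace
of `φ` has absolutely continuous spectral measure, then the singular spectrum is simple. -/
theorem hasSimpleSingularSpectrum_of_absolutelyContinuous {A : H →L[ℂ] H} (hA : IsSelfAdjoint A)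
    (φ e : H)
    (hgen : ∀ K : Submodule ℂ H, IsClosed (K : Set H) → (∀ u ∈ K, A u ∈ K) → φ ∈ K → e ∈ K →
      K = ⊤)
    (hac : spectralMeasure A (e - (cyclicSubspace A φ).starProjection e) ≪ volume) :
    HasSimpleSingularSpectrum A := by
  have hsym : ∀ u v, inner ℂ (A u) v = inner ℂ u (A v) :=
    ContinuousLinearMap.isSelfAdjoint_iff_isSymmetric.1 hA
  set P := (cyclicSubspace A φ).starProjection with hP
  have hPA : ∀ u, P (A u) = A (P u) :=
    starProjection_apply_comm hA _ fun u hu => apply_mem_cyclicSubspace A φ hu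
  have hle : singularSubmodule A ≤ cyclicSubspace A φ := by
    intro η hη
    -- The vectors whose component off the cyclic subspace is orthogonal to every singular vector.
    -- It contains `φ` because `Pφ = φ`, and `e` because of `hac`.
    let K : Submodule ℂ H := ⨅ u : singularSubmodule A,
      ((innerSL ℂ (u : H)).comp (1 - P)).ker
    have hmem : ∀ v, v ∈ K ↔ ∀ u ∈ singularSubmodule A, inner ℂ u (v - P v) = 0 := by
      intro v
      simp [K, Submodule.mem_iInf]
    have hK : K = ⊤ := by
      refine hgen K ?_ ?_ ?_ ?_
      · rw [Submodule.coe_iInf]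
        exact isClosed_iInter fun u => ContinuousLinearMap.isClosed_ker _
      · intro v hv
        rw [hmem] at hv ⊢
        intro u hu
        rw [hPA, ← map_sub, ← hsym]
        exact hv _ (apply_mem_singularSubmodule hu)
      · rw [hmem]
        intro u _
        rw [Submodule.starProjection_eq_self_iff.2 (self_mem_cyclicSubspace A φ), sub_self,
          inner_zero_right]
      · rw [hmem]
        exact fun u hu => inner_eq_zero_of_mutuallySingular hA
          (hu.mono_ac Measure.AbsolutelyContinuous.rfl hac)
    have h1 : inner ℂ η (η - P η) = 0 := (hmem η).1 (hK ▸ Submodule.mem_top) η hη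
    have h2 : inner ℂ (P η) (η - P η) = 0 := by
      rw [← inner_conj_symm, Submodule.starProjection_inner_eq_zero _ _
        (Submodule.starProjection_apply_mem _ η), map_zero]
    have h3 : η - P η = 0 := by
      rw [← inner_self_eq_zero (𝕜 := ℂ)]
      nth_rewrite 1 [inner_sub_left, h1, h2]
      exact sub_zero 0
    exact Submodule.starProjection_eq_self_iff.1 (sub_eq_zero.1 h3).symm
  set Q := (singularSubmodule A).starProjection
  have hQA : ∀ u, Q (A u) = A (Q u) :=
    starProjection_apply_comm hA _ fun u hu => apply_mem_singularSubmodule hu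
  refine ⟨hA, Q φ, ?_⟩
  change (cyclicSubspace A (Q φ) : Set H) = (singularSubmodule A : Set H)
  refine congrArg _ (le_antisymm ?_ ?_)
  · exact cyclicSubspace_le (isClosed_singularSubspace A)
      (fun u hu => apply_mem_singularSubmodule hu) (Submodule.starProjection_apply_mem _ φ)
  · intro η hη
    -- `Q` commutes with `A`, so it carries the cyclic subspace of `φ` into that of `Q φ`, while
    -- fixing singular vectors.
    have hφ : cyclicSubspace A φ ≤ (cyclicSubspace A (Q φ)).comap Q.toLinearMap := by
      refine cyclicSubspace_le ((Submodule.isClosed_topologicalClosure _).preimage Q.continuous)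
        (fun u hu => ?_) (self_mem_cyclicSubspace A _)
      change Q (A u) ∈ cyclicSubspace A (Q φ)
      rw [hQA]
      exact apply_mem_cyclicSubspace A _ hu
    have : Q η ∈ cyclicSubspace A (Q φ) := hφ (hle hη)
    rwa [Submodule.starProjection_eq_self_iff.2 hη] at this

/-- If `w` is the image of `χ` under the resolvent at `x + iε` and `p` is a multiple of the Poisson
kernel, then `⟨χ, p(A) χ⟩` is a multiple of `‖w‖²`. -/
theorem re_inner_cfc_eq_of_resolvent {A : H →L[ℂ] H} (hA : IsSelfAdjoint A) {p : ℝ → ℝ}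
    (hp : Continuous p) {x ε c : ℝ} (hpc : ∀ s, ((s - x) ^ 2 + ε ^ 2) * p s = c) {w χ : H}
    (hw : A w - ((x : ℂ) + ε * Complex.I) • w = χ) :
    (inner ℂ χ (cfc p A χ)).re = c * ‖w‖ ^ 2 := by
  set B := cfc p A with hB
  set T := cfc (fun s => s - x) A with hT
  have hTA : T = A - (x : ℂ) • 1 := by
    rw [hT, cfc_sub (fun s => s) (fun _ => x) A, cfc_id' ℝ A, cfc_const x A,
      Algebra.algebraMap_eq_smul_one]
    rfl
  have hTB : T * B = B * T := (cfc_commute_cfc _ _ A).eq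
  have hq : Continuous fun s : ℝ => s - x := by fun_prop
  have hsum : T * B * T + ε ^ 2 • B = c • 1 := by
    have h1 : T * B = cfc (fun s => (s - x) * p s) A :=
      (cfc_mul (fun s => s - x) p A hq.continuousOn hp.continuousOn).symm
    have h2 : T * B * T = cfc (fun s => (s - x) * p s * (s - x)) A := by
      rw [h1]
      exact (cfc_mul (fun s => (s - x) * p s) (fun s => s - x) A (hq.mul hp).continuousOn
        hq.continuousOn).symm
    have h3 : ε ^ 2 • B = cfc (fun s => ε ^ 2 • p s) A :=
      (cfc_smul (ε ^ 2) p A hp.continuousOn).symm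
    rw [h2, h3, ← Algebra.algebraMap_eq_smul_one, ← cfc_const c A,
      ← cfc_add (a := A) (f := fun s => (s - x) * p s * (s - x)) (g := fun s => ε ^ 2 • p s)
        ((hq.mul hp).mul hq).continuousOn (hp.const_smul (ε ^ 2)).continuousOn]
    refine cfc_congr fun s _ => ?_
    simp only [smul_eq_mul]
    rw [← hpc s]
    ring
  have hTsym : ∀ u v, inner ℂ (T u) v = inner ℂ u (T v) :=
    ContinuousLinearMap.isSelfAdjoint_iff_isSymmetric.1 (cfc_predicate _ A)
  have hχ : χ = T w - (ε * Complex.I) • w := by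
    rw [← hw, hTA, sub_apply, smul_apply, one_apply_eq_self, add_smul]
    abel
  -- Here `χ = (T - iε)w`; the cross terms of `(T + iε)B(T - iε)` cancel because `B` commutes with
  -- `T`.
  have hinner : inner ℂ χ (B χ) = inner ℂ w ((T * B * T + ε ^ 2 • B) w) := by
    have hcomm : T (B w) = B (T w) := congrArg (fun S : H →L[ℂ] H => S w) hTB
    have hsm : (ε ^ 2 • B) w = ((ε : ℂ) ^ 2) • B w := by
      rw [← Complex.ofReal_pow]
      rfl
    rw [hχ, map_sub, map_smul, inner_sub_left, inner_sub_right, inner_sub_right, hTsym, hTsym,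
      inner_smul_left, inner_smul_left, inner_smul_right, map_smul, inner_smul_right, hcomm,
      add_apply, hsm, inner_add_right, inner_smul_right]
    simp only [mul_apply_eq_comp, map_mul, Complex.conj_ofReal, Complex.conj_I]
    linear_combination (-ε ^ 2 * inner ℂ w (B w)) * Complex.I_sq
  have h2 : (c • (1 : H →L[ℂ] H)) w = (c : ℂ) • w := rfl
  rw [hinner, hsum, h2, inner_smul_right, Complex.re_ofReal_mul]
  congr 1
  exact inner_self_eq_norm_sq (𝕜 := ℂ) w

/-- A bound on the Poisson integrals of the spectral measure implies absolute continuity. -/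
theorem absolutelyContinuous_spectralMeasure {A : H →L[ℂ] H} (hA : IsSelfAdjoint A) (χ : H)
    (C : ℝ) (h : ∀ x ε : ℝ, 0 < ε → ∃ w : H,
      A w - ((x : ℂ) + ε * Complex.I) • w = χ ∧ ε * ‖w‖ ^ 2 ≤ C) :
    spectralMeasure A χ ≪ volume := by
  refine absolutelyContinuous_of_closedBall_le (2 * C) fun x ε hε => ?_
  obtain ⟨w, hw, hwC⟩ := h x ε hε
  -- The cutoff is 1 on the spectrum, so that `p(A)` is unchanged, and on the ball, so that the
  -- lower bound `1 ≤ p` there survives.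
  obtain ⟨k, hk1, -, hkc, hk⟩ := exists_continuous_one_zero_of_isCompact
    ((ProperSpace.isCompact_closedBall (0 : ℝ) (‖A‖ * ‖(1 : H →L[ℂ] H)‖)).union
      (ProperSpace.isCompact_closedBall x ε)) isClosed_empty (Set.disjoint_empty _)
  have hden : ∀ s, 0 < (s - x) ^ 2 + ε ^ 2 := fun s => by positivity
  -- The factor 2 gives `p ≥ 1` when `|s - x| ≤ ε`; it is also the 2 in `2 * C`.
  let p : ℝ → ℝ := fun s => 2 * ε ^ 2 / ((s - x) ^ 2 + ε ^ 2)
  have hp : Continuous p := continuous_const.div (by fun_prop) fun s => (hden s).ne'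
  let f : C_c(ℝ, ℝ) := ⟨⟨fun s => p s * k s, by fun_prop⟩, hkc.mul_left⟩
  have hf0 : ∀ s, 0 ≤ f s := fun s => mul_nonneg (by positivity) (hk s).1
  have hmeas : spectralMeasure A χ (Metric.closedBall x ε) ≤
      ENNReal.ofReal (∫ s, f s ∂(spectralMeasure A χ)) := by
    refine (integrable_spectralMeasure A χ f).measure_le_integral (.of_forall hf0) fun s hs => ?_
    change 1 ≤ p s * k s
    rw [hk1 (Or.inr hs), Pi.one_apply, mul_one, one_le_div (hden s)]
    rw [Metric.mem_closedBall, Real.dist_eq] at hs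
    nlinarith [sq_abs (s - x), abs_nonneg (s - x)]
  refine hmeas.trans (ENNReal.ofReal_le_ofReal ?_)
  rw [integral_spectralMeasure]
  have hfp : cfc f A = cfc p A := cfc_congr fun s hs => by
    change p s * k s = p s
    rw [hk1 (Or.inl (mem_closedBall_zero_iff.2 (spectrum.norm_le_norm_mul_of_mem hs))),
      Pi.one_apply, mul_one]
  rw [hfp]
  have hval : (inner ℂ χ (cfc p A χ)).re = 2 * ε ^ 2 * ‖w‖ ^ 2 :=
    re_inner_cfc_eq_of_resolvent hA hp (fun s => mul_div_cancel₀ _ (hden s).ne') hw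
  rw [hval]
  nlinarith

end Spectral

theorem IsSelfAdjoint.exists_resolvent_apply {H : Type*} [NormedAddCommGroup H]
    [InnerProductSpace ℂ H] [CompleteSpace H] {A : H →L[ℂ] H} (hA : IsSelfAdjoint A) {z : ℂ}
    (hz : z.im ≠ 0) (u : H) : ∃ f : H, A f - z • f = u := by
  have hnot : z ∉ spectrum ℂ A := fun h => hz (hA.im_eq_zero_of_mem_spectrum h)
  rw [spectrum.notMem_iff] at hnot
  obtain ⟨U, hU⟩ := hnot
  refine ⟨-((↑U⁻¹ : H →L[ℂ] H) u), ?_⟩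
  have h : (↑U : H →L[ℂ] H) ((↑U⁻¹ : H →L[ℂ] H) u) = u := by
    rw [← mul_apply_eq_comp, U.mul_inv, one_apply_eq_self]
  rw [hU, sub_apply, Algebra.algebraMap_eq_smul_one, smul_apply, one_apply_eq_self] at h
  rw [map_neg, smul_neg]
  nth_rewrite 3 [← h]
  abel

/-! ### Jacobi operators and half-line Weyl solutions. -/

/-- The standard basis vectors of `ℓ²(ℤ)`. -/
noncomputable def stdVec (n : ℤ) : L2Z := lp.single 2 n 1

theorem stdVec_apply (n m : ℤ) : stdVec n m = if m = n then 1 else 0 := by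
  rw [stdVec, lp.coeFn_single, Pi.single_apply]

theorem inner_stdVec_right (f : L2Z) (n : ℤ) :
    inner ℂ f (stdVec n) = (starRingEnd ℂ) (f n) := by
  rw [stdVec, lp.inner_single_right]
  simp

theorem jacobi_stdVec (a b : ℤ → ℝ) (hab : BddAbove (Set.range fun n => |a n| + |b n|)) (n : ℤ) :
    jacobi a b hab (stdVec n) = (a n : ℂ) • stdVec (n + 1) + (b n : ℂ) • stdVec n +
      (a (n - 1) : ℂ) • stdVec (n - 1) := by
  ext m
  rw [jacobi_apply]
  simp only [lp.coeFn_add, lp.coeFn_smul, Pi.add_apply, Pi.smul_apply, smul_eq_mul, stdVec_apply]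
  rcases eq_or_ne m n with rfl | h1
  · simp [show m ≠ m - 1 by omega]
  rcases eq_or_ne m (n + 1) with rfl | h2
  · simp [show n + 1 + 1 ≠ n by omega, show n + 1 ≠ n - 1 by omega]
  rcases eq_or_ne m (n - 1) with rfl | h3
  · simp [show n - 1 - 1 ≠ n by omega, show n - 1 ≠ n + 1 by omega]
  · simp [h1, h2, h3, show m - 1 ≠ n by omega, show m + 1 ≠ n by omega]

/-- Two neighbouring basis vectors generate `ℓ²(ℤ)` under a Jacobi operator. -/
theorem eq_top_of_stdVec_mem {a b : ℤ → ℝ} (ha : ∀ n, 0 < a n)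
    (hab : BddAbove (Set.range fun n => |a n| + |b n|)) (K : Submodule ℂ L2Z)
    (hK : IsClosed (K : Set L2Z)) (hJ : ∀ u ∈ K, jacobi a b hab u ∈ K) (h0 : stdVec 0 ∈ K)
    (h1 : stdVec 1 ∈ K) : K = ⊤ := by
  have ha' : ∀ n, (a n : ℂ) ≠ 0 := fun n => Complex.ofReal_ne_zero.2 (ha n).ne'
  have hstep : ∀ n, stdVec n ∈ K → stdVec (n - 1) ∈ K → stdVec (n + 1) ∈ K := by
    intro n hn hn'
    have h := hJ _ hn
    rw [jacobi_stdVec, K.add_mem_iff_left (K.smul_mem _ hn'),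
      K.add_mem_iff_left (K.smul_mem _ hn)] at h
    exact (K.smul_mem_iff (ha' n)).1 h
  have hstep' : ∀ n, stdVec n ∈ K → stdVec (n + 1) ∈ K → stdVec (n - 1) ∈ K := by
    intro n hn hn'
    have h := hJ _ hn
    rw [jacobi_stdVec, K.add_mem_iff_right (K.add_mem (K.smul_mem _ hn') (K.smul_mem _ hn))] at h
    exact (K.smul_mem_iff (ha' _)).1 h
  have hall : ∀ n : ℤ, stdVec n ∈ K ∧ stdVec (n + 1) ∈ K := by
    intro n
    induction n using Int.induction_on with
    | zero => exact ⟨h0, by simpa using h1⟩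
    | succ n ih => exact ⟨ih.2, hstep _ ih.2 (by simpa using ih.1)⟩
    | pred n ih => exact ⟨hstep' _ ih.1 ih.2, by simpa using ih.1⟩
  refine eq_top_iff.2 fun u _ => ?_
  have hsum := lp.hasSum_single (E := fun _ : ℤ => ℂ) (p := 2) ENNReal.ofNat_ne_top u
  refine hK.mem_of_tendsto hsum (.of_forall fun s => K.sum_mem fun n _ => ?_)
  have : lp.single (E := fun _ : ℤ => ℂ) 2 n (u n) = u n • stdVec n := by
    ext m
    simp [stdVec, Pi.single_apply]
  rw [this]
  exact K.smul_mem _ (hall n).1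

/-- A Weyl solution on the half-line `n ≥ 1`: it is supported there, solves the eigenvalue equation
up to the two boundary terms, and its boundary value `m` is a Herglotz function of `z`. -/
theorem exists_halfLine_solution (a b : ℤ → ℝ)
    (hab : BddAbove (Set.range fun n => |a n| + |b n|)) (z : ℂ) (hz : z.im ≠ 0) :
    ∃ (f : L2Z) (m : ℂ),
      jacobi a b hab f - z • f = stdVec 1 + (a 0 * m) • stdVec 0 ∧ m.im = z.im * ‖f‖ ^ 2 := by
  -- Truncation keeps the half-line operator inside `ℓ²(ℤ)`: as `a' 0 = 0`, it decouples from `n ≤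
  -- 0`, where the equation reduces to `-z * f n = 0`. Restoring the coupling `a 0` adds only the
  -- term at site 0.
  let a' : ℤ → ℝ := fun n => if 1 ≤ n then a n else 0
  let b' : ℤ → ℝ := fun n => if 1 ≤ n then b n else 0
  have hab' : BddAbove (Set.range fun n => |a' n| + |b' n|) := by
    obtain ⟨C, hC⟩ := hab
    refine ⟨C, ?_⟩
    rintro _ ⟨n, rfl⟩
    have h := hC ⟨n, rfl⟩
    by_cases hn : 1 ≤ n
    · simpa [a', b', hn] using h
    · simpa [a', b', hn] using (by positivity : 0 ≤ |a n| + |b n|).trans h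
  obtain ⟨f, hf⟩ := (isSelfAdjoint_jacobi a' b' hab').exists_resolvent_apply hz (stdVec 1)
  have hz0 : z ≠ 0 := fun h => hz (by simp [h])
  have hfn : ∀ n, a' (n - 1) * f (n - 1) + b' n * f n + a' n * f (n + 1) - z * f n =
      if n = 1 then 1 else 0 := by
    intro n
    have h := congrArg (fun g : L2Z => g n) hf
    simpa only [lp.coeFn_sub, lp.coeFn_smul, Pi.sub_apply, Pi.smul_apply, smul_eq_mul,
      jacobi_apply, stdVec_apply] using h
  have hf0 : ∀ n, n ≤ 0 → f n = 0 := by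
    intro n hn
    have h := hfn n
    simp only [a', b', show ¬ (1 ≤ n) by omega, show ¬ (1 ≤ n - 1) by omega,
      show ¬ (n = 1) by omega, if_false, Complex.ofReal_zero, zero_mul, zero_add, zero_sub,
      neg_eq_zero, mul_eq_zero, hz0, false_or] at h
    exact h
  have hsol : jacobi a b hab f - z • f = stdVec 1 + (a 0 * f 1) • stdVec 0 := by
    ext n
    simp only [lp.coeFn_sub, lp.coeFn_add, lp.coeFn_smul, Pi.sub_apply, Pi.add_apply,
      Pi.smul_apply, smul_eq_mul, jacobi_apply, stdVec_apply, mul_ite, mul_one, mul_zero]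
    rw [← hfn n]
    rcases lt_trichotomy n 0 with hn | rfl | hn
    · simp [hf0 n hn.le, hf0 (n - 1) (by omega), hf0 (n + 1) (by omega), hn.ne]
    · simp [hf0 0 le_rfl, hf0 (-1) (by omega), a']
    · rcases eq_or_ne n 1 with rfl | hn1
      · simp [a', b', hf0 0 le_rfl]
      · simp [a', b', hn.ne', show 1 ≤ n by omega, show 1 ≤ n - 1 by omega]
  refine ⟨f, f 1, hsol, ?_⟩
  -- `⟨f, Jf⟩` is real and the term at site 0 drops out since `f 0 = 0`; what remains is `-Im z ‖f‖²
  -- = -Im (f 1)`.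
  have hin := congrArg (fun g => (inner ℂ f g).im) hsol
  have him : (inner ℂ f (jacobi a b hab f)).im = 0 := by
    have hsym : inner ℂ (jacobi a b hab f) f = inner ℂ f (jacobi a b hab f) :=
      ContinuousLinearMap.isSelfAdjoint_iff_isSymmetric.1 (isSelfAdjoint_jacobi a b hab) f f
    rw [← Complex.conj_eq_iff_im, inner_conj_symm, hsym]
  have hff : inner ℂ f f = ((‖f‖ ^ 2 : ℝ) : ℂ) := by
    rw [inner_self_eq_norm_sq_to_K, Complex.ofReal_pow]
    rfl
  simp only [inner_sub_right, inner_add_right, inner_smul_right, inner_stdVec_right, hf0 0 le_rfl,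
    hff, map_zero, mul_zero, add_zero, Complex.sub_im, him, Complex.im_mul_ofReal,
    Complex.conj_im, zero_sub, neg_inj] at hin
  exact hin.symm

theorem theorem3p1 (a b : ℤ → ℝ) (ha : ∀ n, 0 < a n)
    (hab : BddAbove (Set.range fun n => |a n| + |b n|)) :
    HasSimpleSingularSpectrum (jacobi a b hab) := by
  have hJ := isSelfAdjoint_jacobi a b hab
  set J := jacobi a b hab with hJdef
  -- The non-real coefficient is what matters: it contributes 1 to `c.im` below, which keeps `c`
  -- away from zero.
  let φ : L2Z := stdVec 0 + Complex.I • stdVec 1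
  refine hasSimpleSingularSpectrum_of_absolutelyContinuous hJ φ (stdVec 0) ?_ ?_
  · intro K hK hKJ hφ h0
    refine eq_top_of_stdVec_mem ha hab K hK hKJ h0 ?_
    exact (K.smul_mem_iff Complex.I_ne_zero).1 ((K.add_mem_iff_right h0).1 hφ)
  set K := cyclicSubspace J φ
  set P := K.starProjection
  have hPJ : ∀ u, P (J u) = J (P u) :=
    starProjection_apply_comm hJ K fun u hu => apply_mem_cyclicSubspace J φ hu
  have hPφ : P φ = φ := Submodule.starProjection_eq_self_iff.2 (self_mem_cyclicSubspace J φ)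
  have h01 : stdVec 1 - P (stdVec 1) = Complex.I • (stdVec 0 - P (stdVec 0)) := by
    have h : stdVec 1 = Complex.I • stdVec 0 - Complex.I • φ := by
      simp [φ, smul_smul]
    rw [h, map_sub, map_smul, map_smul, hPφ, smul_sub]
    abel
  -- The constant is the maximum of `t / (1 + a 0 * t) ^ 2` over `t ≥ 0`, reached at `t = 1 / a 0`.
  refine absolutelyContinuous_spectralMeasure hJ _ (1 / (4 * a 0)) fun x ε hε => ?_
  set z : ℂ := (x : ℂ) + ε * Complex.I
  have hzim : z.im = ε := by simp [z]
  obtain ⟨f, m, hf, hm⟩ := exists_halfLine_solution a b hab z (by rw [hzim]; exact hε.ne')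
  rw [hzim] at hm
  set c : ℂ := Complex.I + a 0 * m
  have hcim : c.im = 1 + a 0 * (ε * ‖f‖ ^ 2) := by simp [c, hm]
  have ha0 := ha 0
  have hcpos : 0 < c.im := by rw [hcim]; positivity
  have hc : c ≠ 0 := fun h => hcpos.ne' (by simp [h])
  have hg : J (f - P f) - z • (f - P f) = c • (stdVec 0 - P (stdVec 0)) := by
    calc J (f - P f) - z • (f - P f) = (J f - z • f) - P (J f - z • f) := by
          rw [map_sub, map_sub, map_smul, hPJ, smul_sub]; abel
      _ = (stdVec 1 - P (stdVec 1)) + (a 0 * m) • (stdVec 0 - P (stdVec 0)) := by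
          rw [hf, map_add, map_smul, smul_sub]; abel
      _ = _ := by rw [h01, ← add_smul]
  refine ⟨c⁻¹ • (f - P f), ?_, ?_⟩
  · rw [map_smul, smul_comm, ← smul_sub, hg, inv_smul_smul₀ hc]
  · have hfP : ‖f - P f‖ ≤ ‖f‖ := by
      have h := K.norm_sq_eq_add_norm_sq_starProjection f
      rw [Submodule.starProjection_orthogonal_val] at h
      exact le_of_sq_le_sq (by nlinarith [sq_nonneg ‖P f‖]) (norm_nonneg f)
    have hcn : c.im ≤ ‖c‖ := (le_abs_self _).trans (Complex.abs_im_le_norm c)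
    have hn : ‖c⁻¹ • (f - P f)‖ ≤ ‖f‖ / c.im := by
      rw [norm_smul, norm_inv, inv_mul_eq_div]
      gcongr
    calc ε * ‖c⁻¹ • (f - P f)‖ ^ 2 ≤ ε * (‖f‖ / c.im) ^ 2 := by gcongr
      _ = (ε * ‖f‖ ^ 2) / c.im ^ 2 := by ring
      _ ≤ 1 / (4 * a 0) := by
        rw [div_le_div_iff₀ (by positivity) (by positivity), hcim]
        nlinarith [sq_nonneg (1 - a 0 * (ε * ‖f‖ ^ 2))]
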